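/- Let $\Gamma$ be a connected graph with graph distance $d$ (we identify $\Gamma$ with its vertex set). Assume that $\Gamma$ is hyperbolic, i.e. there is $\delta>0$ such that in every geodesic triangle each edge is contained in the $\delta$-neighborhood of the union of the other two, and that $\Gamma$ has bounded degree, i.e. $\sup_{x\in\Gamma}|\{y : d(x,y)<R\}|<\infty$ for every $R>0$. For a kernel $k\colon\Gamma\times\Gamma\to\mathbb{C}$, the Schur multiplier associated with $k$ is the map $m_k\colon[A_{x,y}]\mapsto[k(x,y)A_{x,y}]$ on $\mathbb{B}(\ell_2\Gamma)$, where $A_{x,y}=\langle A\delta_y,\delta_x\rangle$; let $V_2(\Gamma)$ be the space of all everywhere defined and bounded Schur multipliers on $\mathbb{B}(\ell_2\Gamma)$, with the operator norm $\|m_k\|$. Let $\|\cdot\|_{\mathrm{cb}}$ denote the completely bounded norm and put $\mathbb{D}=\{z\in\mathbb{C}:|z|<1\}$, $\mathbb{N}_0=\{0,1,2,\dots\}$. Then there exists a constant $C>0$ such that the following are true. (1) For every $z\in\mathbb{D}$, the Schur multiplier $\theta_z$ associated with the kernel $(x,y)\mapsto z^{d(x,y)}$ belongs to $V_2(\Gamma)$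 and satisfies $\|\theta_z\|_{\mathrm{cb}}\le C\,|1-z|/(1-|z|)$. Moreover, $z\mapsto\theta_z$ is a holomorphic map from $\mathbb{D}$ into $V_2(\Gamma)$. (2) For every $n\in\mathbb{N}_0$, the Schur multiplier associated with the characteristic function of $\{(x,y)\in\Gamma\times\Gamma : d(x,y)=n\}$ belongs to $V_2(\Gamma)$ and has completely bounded norm at most $C(n+1)$. (3) There exists a sequence of finitely supported functions $f_n\colon\mathbb{N}_0\to[0,1]$ such that $f_n\to1$ pointwise and, for every $n$, the Schur multiplier associated with the kernel $(x,y)\mapsto f_n(d(x,y))$ belongs to $V_2(\Gamma)$ and has completely bounded norm at most $C$. -/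

import Mathlib

open Set Filter Topology Metric
open scoped ENNReal

noncomputable section

/-! ### Hyperbolic graphs -/

namespace SimpleGraph

variable {V : Type*} (G : SimpleGraph V)

/-- `s` is the set of vertices of a geodesic path `p 0, p 1, …, p n` from `x` to `y`. -/
def IsGeodesicSegment (x y : V) (s : Set V) : Prop :=
  ∃ (n : ℕ) (p : ℕ → V), p 0 = x ∧ p n = y ∧
    (∀ i ≤ n, ∀ j ≤ n, (G.dist (p i) (p j) : ℤ) = |(i : ℤ) - (j : ℤ)|) ∧
    s = p '' Set.Iic n

/-- The (open) `R`-neighbourhood of a set of vertices for the graph distance. -/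
def nbhd (R : ℝ) (E : Set V) : Set V := {x | ∃ y ∈ E, (G.dist x y : ℝ) < R}

/-- A connected graph is hyperbolic if its geodesic triangles are uniformly slim: each edge lies in
the `δ`-neighbourhood of the union of the other two. (All three edges are covered by permuting the
vertices.) -/
def IsHyperbolic : Prop :=
  ∃ δ : ℝ, 0 < δ ∧ ∀ (x y z : V) (a b c : Set V),
    G.IsGeodesicSegment x y a → G.IsGeodesicSegment y z b → G.IsGeodesicSegment z x c →
      a ⊆ G.nbhd δ (b ∪ c) ∧ b ⊆ G.nbhd δ (c ∪ a) ∧ c ⊆ G.nbhd δ (a ∪ b)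

/-- Bounded degree: balls of any fixed radius have uniformly bounded cardinality. -/
def HasBoundedDegree : Prop :=
  ∀ R : ℝ, 0 < R → ∃ N : ℕ, ∀ x : V, (G.nbhd R {x}).encard ≤ N

end SimpleGraph

/-! ### The completely bounded norm -/

section CompletelyBounded

variable {H : Type*} [NormedAddCommGroup H] [InnerProductSpace ℂ H]

/-- The operator on the Hilbert space direct sum `Hⁿ` given by an `n × n` matrix of operators
on `H`, that is `(v j)_j ↦ (∑ j, A i j (v j))_i`. Its operator norm is the norm of `A` in
`Mₙ(𝔹(H))`. -/
def blockOperator {n : ℕ} (A : Matrix (Fin n) (Fin n) (H →L[ℂ] H)) :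
    PiLp 2 (fun _ : Fin n => H) →L[ℂ] PiLp 2 (fun _ : Fin n => H) :=
  ((PiLp.continuousLinearEquiv 2 ℂ (fun _ : Fin n => H)).symm :
      (Fin n → H) →L[ℂ] PiLp 2 (fun _ : Fin n => H)) ∘L
    ContinuousLinearMap.pi (fun i => ∑ j, A i j ∘L PiLp.proj 2 (fun _ : Fin n => H) j)

/-- The completely bounded norm of a linear map `T` on `𝔹(H)`: the supremum over `n` of the norms
of the maps `[A i j] ↦ [T (A i j)]` on `Mₙ(𝔹(H))`. -/
def cbNorm (T : (H →L[ℂ] H) →L[ℂ] (H →L[ℂ] H)) : ℝ≥0∞ :=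
  ⨆ (n : ℕ) (A : Matrix (Fin n) (Fin n) (H →L[ℂ] H)) (_ : ‖blockOperator A‖ ≤ 1),
    ‖blockOperator (A.map T)‖ₑ

end CompletelyBounded

/-! ### Schur multipliers -/

section Schur

variable (V : Type*)

/-- The Hilbert space `ℓ₂(V)` of square summable complex functions on `V`. -/
abbrev EllTwo : Type _ := lp (fun _ : V => ℂ) 2

/-- The algebra `𝔹(ℓ₂(V))` of bounded operators on `ℓ₂(V)`, with the operator norm. -/
abbrev BoundedOps : Type _ := EllTwo V →L[ℂ] EllTwo V

variable {V}

open Classical in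
/-- The matrix entry `A_{x,y} = ⟨A δ_y, δ_x⟩`, that is the value of `A δ_y` at `x`. -/
def matrixEntry (A : BoundedOps V) (x y : V) : ℂ :=
  (A (lp.single 2 y (1 : ℂ)) : V → ℂ) x

/-- The bounded map `m` on `𝔹(ℓ₂(V))` is the Schur multiplier with kernel `k`:
`m [A_{x,y}] = [k(x,y) A_{x,y}]`. -/
def IsSchurMultiplier (k : V → V → ℂ) (m : BoundedOps V →L[ℂ] BoundedOps V) : Prop :=
  ∀ (A : BoundedOps V) (x y : V), matrixEntry (m A) x y = k x y * matrixEntry A x y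

variable (V)

/-- The space `V₂(V)` of all bounded Schur multipliers on `𝔹(ℓ₂(V))`, with the norm of bounded
linear maps on `𝔹(ℓ₂(V))`. -/
def schurMultipliers : Submodule ℂ (BoundedOps V →L[ℂ] BoundedOps V) where
  carrier := {m | ∃ k : V → V → ℂ, IsSchurMultiplier k m}
  zero_mem' := ⟨0, fun A x y => by simp [matrixEntry]⟩
  add_mem' := by
    rintro m m' ⟨k, hk⟩ ⟨k', hk'⟩
    refine ⟨k + k', fun A x y => ?_⟩
    have h := hk A x y
    have h' := hk' A x y
    simp only [matrixEntry] at h h' ⊢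
    simp [h, h', add_mul]
  smul_mem' := by
    rintro c m ⟨k, hk⟩
    refine ⟨c • k, fun A x y => ?_⟩
    have h := hk A x y
    simp only [matrixEntry] at h ⊢
    simp [h, mul_assoc]

end Schur

end

/-! Fix a base point o. Walking k steps from x towards o leads to a set of approximate positions,
the `shadow` of x at depth k. Thin triangles and bounded degree bound its size uniformly. They also
make the shadows of x and y at depths k and l meet exactly when d(x,y) ≤ k + l, provided k - l is
d(x,o) - d(y,o) up to parity, so that both walks stop at about the same distance from o.

Whether two finite sets meet is a scalar product: inclusion-exclusion sums (-1)^(|ω|+1) over the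
nonempty finite ω contained in both sets, and this condition separates the variables. Weighting the
depths by square summable φ, ψ and summing over n = k + l realises the kernel ∑_{n ≥ d(x,y)} φ(k)
ψ(n-k) as a scalar product of bounded vectors. Its multiplier has the form A ↦ P*(A ⊗ 1)Q, with cb
norm at most K‖φ‖‖ψ‖. This is `IsHyperbolic.exists_schurMultiplier`; it rests on
`IsHyperbolic.shadow_inter_shadow`, `IsHyperbolic.exists_encard_shadow_le` and
`exists_schurMultiplier_of_tsum`.

The choice φ(k) = ψ(k) = z^k gives z^d/(1-z), hence the bound in (1). Point masses give the
indicator of d ≤ n as n + 1 bounded pieces, and differences give (2). By this linear growth the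
power series of θ_z in the sphere multipliers converges in norm, so θ is holomorphic. For 0 ≤ r < 1
the bound in (1) does not depend on r, and truncating the series of θ_r far out, with r → 1, gives
(3). -/

/-! ### Square summable families -/

section LpTwo

variable {ι : Type*} {E : ι → Type*} [∀ i, NormedAddCommGroup (E i)]

theorem memℓp_two_iff_summable {f : ∀ i, E i} :
    Memℓp f 2 ↔ Summable fun i => ‖f i‖ ^ 2 := by
  rw [memℓp_gen_iff (by norm_num)]
  simp

theorem memℓp_two_iff_tsum_enorm {f : ∀ i, E i} :
    Memℓp f 2 ↔ ∑' i, ‖f i‖ₑ ^ 2 ≠ ∞ := by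
  rw [memℓp_two_iff_summable]
  have h : ∀ i, ‖f i‖ₑ ^ 2 = ENNReal.ofReal (‖f i‖ ^ 2) := fun i => by
    rw [ENNReal.ofReal_pow (norm_nonneg _), ofReal_norm]
  simp_rw [h]
  refine ⟨fun hs => hs.tsum_ofReal_ne_top, fun hs => ?_⟩
  have := ENNReal.summable_toReal hs
  simpa [ENNReal.toReal_ofReal] using this

theorem lp.norm_sq_eq_tsum (f : lp E 2) : ‖f‖ ^ 2 = ∑' i, ‖f i‖ ^ 2 := by
  have := lp.norm_rpow_eq_tsum (p := 2) (by norm_num) f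
  simpa using this

theorem lp.enorm_sq_eq_tsum (f : lp E 2) : ‖f‖ₑ ^ 2 = ∑' i, ‖f i‖ₑ ^ 2 := by
  have h : ∀ i, ‖f i‖ₑ ^ 2 = ENNReal.ofReal (‖f i‖ ^ 2) := fun i => by
    rw [ENNReal.ofReal_pow (norm_nonneg _), ofReal_norm]
  simp_rw [h]
  rw [← ENNReal.ofReal_tsum_of_nonneg (fun _ => by positivity)
    (memℓp_two_iff_summable.1 (lp.memℓp f)), ← lp.norm_sq_eq_tsum,
    ENNReal.ofReal_pow (norm_nonneg _), ofReal_norm]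

end LpTwo

section ENorm

variable {E F : Type*} [NormedAddCommGroup E] [NormedSpace ℂ E] [NormedAddCommGroup F]
  [NormedSpace ℂ F] (φ : E →L[ℂ] F)

theorem ContinuousLinearMap.enorm_map_sub_le (x y : E) : ‖φ (x - y)‖ₑ ≤ ‖φ x‖ₑ + ‖φ y‖ₑ := by
  rw [map_sub]
  exact enorm_sub_le

theorem ContinuousLinearMap.enorm_map_smul (c : ℂ) (x : E) : ‖φ (c • x)‖ₑ = ‖c‖ₑ * ‖φ x‖ₑ := by
  rw [map_smul, enorm_smul]

theorem ContinuousLinearMap.enorm_map_sum_le {ι : Type*} (s : Finset ι) (x : ι → E) :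
    ‖φ (∑ i ∈ s, x i)‖ₑ ≤ ∑ i ∈ s, ‖φ (x i)‖ₑ := by
  rw [map_sum]
  exact enorm_sum_le _ _

end ENorm

/-- The identification of `(⨁ᵢ H)ⁿ` with `⨁ᵢ Hⁿ`. -/
theorem exists_lp_piLp {H I : Type*} [NormedAddCommGroup H] {n : ℕ} (f : Fin n → lp (fun _ : I => H) 2) :
    ∃ F : lp (fun _ : I => PiLp 2 (fun _ : Fin n => H)) 2,
      (∀ i j, F i j = f j i) ∧ ‖F‖ ^ 2 = ∑ j, ‖f j‖ ^ 2 := by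
  have hs : ∀ j, Summable fun i => ‖f j i‖ ^ 2 := fun j =>
    memℓp_two_iff_summable.1 (lp.memℓp (f j))
  have hn : ∀ i, ‖(WithLp.toLp 2 fun j => f j i : PiLp 2 (fun _ : Fin n => H))‖ ^ 2
      = ∑ j, ‖f j i‖ ^ 2 := fun i => by
    rw [PiLp.norm_sq_eq_of_L2]
  refine ⟨⟨fun i => WithLp.toLp 2 fun j => f j i, memℓp_two_iff_summable.2 ?_⟩,
    fun i j => rfl, ?_⟩
  · simp_rw [hn]
    exact summable_sum fun j _ => hs j
  · rw [lp.norm_sq_eq_tsum]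
    simp_rw [hn, lp.norm_sq_eq_tsum]
    exact Summable.tsum_finsetSum fun j _ => hs j

/-! ### The completely bounded norm -/

section CompletelyBounded

variable {H : Type*} [NormedAddCommGroup H] [InnerProductSpace ℂ H]

theorem blockOperator_apply {n : ℕ} (A : Matrix (Fin n) (Fin n) (H →L[ℂ] H))
    (v : PiLp 2 (fun _ : Fin n => H)) (i : Fin n) :
    blockOperator A v i = ∑ j, A i j (v j) := by
  simp [blockOperator]

theorem norm_blockOperator_le {n : ℕ} (A : Matrix (Fin n) (Fin n) (H →L[ℂ] H)) :
    ‖blockOperator A‖ ≤ ∑ i, ∑ j, ‖A i j‖ := by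
  refine ContinuousLinearMap.opNorm_le_bound _ (by positivity) fun v => ?_
  have h1 : ‖blockOperator A v‖ ≤ ∑ i, ‖blockOperator A v i‖ := by
    rw [PiLp.norm_eq_of_L2]
    refine Real.sqrt_le_iff.2 ⟨by positivity, ?_⟩
    exact Finset.sum_sq_le_sq_sum_of_nonneg fun _ _ => norm_nonneg _
  refine h1.trans ?_
  rw [Finset.sum_mul]
  refine Finset.sum_le_sum fun i _ => ?_
  rw [blockOperator_apply, Finset.sum_mul]
  refine (norm_sum_le _ _).trans (Finset.sum_le_sum fun j _ => ?_)
  refine ((A i j).le_opNorm _).trans ?_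
  gcongr
  exact PiLp.norm_apply_le v j

/-- The functional `T ↦ ⟨v, blockOperator (A.map T) u⟩`. -/
noncomputable def blockFunctional {n : ℕ} (A : Matrix (Fin n) (Fin n) (H →L[ℂ] H))
    (u v : PiLp 2 (fun _ : Fin n => H)) : ((H →L[ℂ] H) →L[ℂ] (H →L[ℂ] H)) →L[ℂ] ℂ :=
  ∑ i, ∑ j, (innerSL ℂ (v i) ∘L ContinuousLinearMap.apply ℂ H (u j)) ∘L
    ContinuousLinearMap.apply ℂ (H →L[ℂ] H) (A i j)

theorem blockFunctional_apply {n : ℕ} (A : Matrix (Fin n) (Fin n) (H →L[ℂ] H))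
    (u v : PiLp 2 (fun _ : Fin n => H)) (T : (H →L[ℂ] H) →L[ℂ] (H →L[ℂ] H)) :
    blockFunctional A u v T = inner ℂ v (blockOperator (A.map T) u) := by
  simp [blockFunctional, PiLp.inner_apply, blockOperator_apply, inner_sum, sum_apply]

/-- Exhibits the cb norm as a supremum of moduli of continuous linear functionals of T.
Subadditivity, homogeneity and the bound for infinite sums are then inherited from ℂ. -/
theorem cbNorm_le_iff {T : (H →L[ℂ] H) →L[ℂ] (H →L[ℂ] H)} {c : ℝ≥0∞} :
    cbNorm T ≤ c ↔ ∀ (n : ℕ) (A : Matrix (Fin n) (Fin n) (H →L[ℂ] H)),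
      ‖blockOperator A‖ ≤ 1 → ∀ u v, ‖u‖ = 1 → ‖v‖ = 1 → ‖blockFunctional A u v T‖ₑ ≤ c := by
  simp only [cbNorm, iSup_le_iff, blockFunctional_apply]
  refine forall_congr' fun n => forall_congr' fun A => forall_congr' fun _ => ?_
  by_cases hc : c = ∞
  · simp [hc]
  simp_rw [← ofReal_norm, ENNReal.ofReal_le_iff_le_toReal hc]
  refine ⟨fun h u v hu hv => ?_, fun h => ?_⟩
  · refine (norm_inner_le_norm _ _).trans ?_
    rw [hv, one_mul]
    simpa [hu] using (blockOperator (A.map T)).le_of_opNorm_le h u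
  · refine ContinuousLinearMap.opNorm_le_of_re_inner_le (𝕜 := ℂ) ENNReal.toReal_nonneg
      fun u v hu hv => ?_
    refine (RCLike.re_le_norm _).trans ?_
    rw [norm_inner_symm]
    exact h u v hu hv

theorem enorm_blockFunctional_le_cbNorm (T : (H →L[ℂ] H) →L[ℂ] (H →L[ℂ] H)) {n : ℕ}
    (A : Matrix (Fin n) (Fin n) (H →L[ℂ] H)) (hA : ‖blockOperator A‖ ≤ 1)
    (u v : PiLp 2 (fun _ : Fin n => H)) (hu : ‖u‖ = 1) (hv : ‖v‖ = 1) :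
    ‖blockFunctional A u v T‖ₑ ≤ cbNorm T :=
  cbNorm_le_iff.1 le_rfl n A hA u v hu hv

theorem cbNorm_sub_le (S T : (H →L[ℂ] H) →L[ℂ] (H →L[ℂ] H)) :
    cbNorm (S - T) ≤ cbNorm S + cbNorm T :=
  cbNorm_le_iff.2 fun _ A hA u v hu hv => ((blockFunctional A u v).enorm_map_sub_le S T).trans
    (add_le_add (enorm_blockFunctional_le_cbNorm S A hA u v hu hv) (enorm_blockFunctional_le_cbNorm T A hA u v hu hv))

theorem cbNorm_smul_le (c : ℂ) (T : (H →L[ℂ] H) →L[ℂ] (H →L[ℂ] H)) :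
    cbNorm (c • T) ≤ ‖c‖ₑ * cbNorm T :=
  cbNorm_le_iff.2 fun _ A hA u v hu hv => ((blockFunctional A u v).enorm_map_smul c T).le.trans
    (mul_le_mul_right (enorm_blockFunctional_le_cbNorm T A hA u v hu hv) _)

theorem cbNorm_sum_le {ι : Type*} (s : Finset ι) (T : ι → (H →L[ℂ] H) →L[ℂ] (H →L[ℂ] H)) :
    cbNorm (∑ i ∈ s, T i) ≤ ∑ i ∈ s, cbNorm (T i) :=
  cbNorm_le_iff.2 fun _ A hA u v hu hv => ((blockFunctional A u v).enorm_map_sum_le s T).trans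
    (Finset.sum_le_sum fun i _ => enorm_blockFunctional_le_cbNorm (T i) A hA u v hu hv)

/-- Convergence in operator norm suffices, since each block functional is continuous for it. -/
theorem cbNorm_le_tsum {ι : Type*} {T : ι → (H →L[ℂ] H) →L[ℂ] (H →L[ℂ] H)}
    {S : (H →L[ℂ] H) →L[ℂ] (H →L[ℂ] H)} (h : HasSum T S) :
    cbNorm S ≤ ∑' i, cbNorm (T i) := by
  refine cbNorm_le_iff.2 fun n A hA u v hu hv => ?_
  have h1 : HasSum (fun i => blockFunctional A u v (T i)) (blockFunctional A u v S) :=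
    h.mapL (blockFunctional A u v)
  rw [← h1.tsum_eq]
  exact enorm_tsum_le_tsum_enorm.trans
    (ENNReal.tsum_le_tsum fun i => enorm_blockFunctional_le_cbNorm (T i) A hA u v hu hv)

/-- The case n = 1 of the supremum. It turns cb bounds into norm bounds for the convergence of power
series. -/
theorem enorm_le_cbNorm (T : (H →L[ℂ] H) →L[ℂ] (H →L[ℂ] H)) : ‖T‖ₑ ≤ cbNorm T := by
  by_cases hT : cbNorm T = ∞
  · simp [hT]
  rw [← ofReal_norm, ENNReal.ofReal_le_iff_le_toReal hT]
  refine ContinuousLinearMap.opNorm_le_of_unit_norm ENNReal.toReal_nonneg fun A hA => ?_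
  refine ContinuousLinearMap.opNorm_le_of_re_inner_le (𝕜 := ℂ) ENNReal.toReal_nonneg
    fun u v hu hv => ?_
  refine (RCLike.re_le_norm _).trans ?_
  rw [norm_inner_symm]
  have h := enorm_blockFunctional_le_cbNorm T (fun _ _ : Fin 1 => A)
    ((norm_blockOperator_le _).trans (by simp [hA])) (WithLp.toLp 2 fun _ => u)
    (WithLp.toLp 2 fun _ => v)
    (by simp [PiLp.norm_eq_of_L2, hu]) (by simp [PiLp.norm_eq_of_L2, hv])
  rw [← ofReal_norm, ENNReal.ofReal_le_iff_le_toReal hT] at h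
  simpa [blockFunctional] using h

/-- The diagonal action of an operator on a Hilbert space direct sum of copies of `H`. -/
noncomputable def amplification (I : Type*) (A : H →L[ℂ] H) :
    lp (fun _ : I => H) 2 →L[ℂ] lp (fun _ : I => H) 2 :=
  lp.mapCLM 2 (fun _ => A) (norm_nonneg A) fun _ => le_rfl

theorem amplification_apply {I : Type*} (A : H →L[ℂ] H) (u : lp (fun _ : I => H) 2) (i : I) :
    amplification I A u i = A (u i) := rfl

theorem norm_amplification_le {I : Type*} (A : H →L[ℂ] H) : ‖amplification I A‖ ≤ ‖A‖ :=
  lp.norm_mapCLM_le _ _ _ _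

section Compression

variable [CompleteSpace H] {I : Type*}

/-- The map `A ↦ P* (A ⊗ 1) Q` on `𝔹(H)`. -/
noncomputable def compression (P Q : H →L[ℂ] lp (fun _ : I => H) 2) :
    (H →L[ℂ] H) →L[ℂ] (H →L[ℂ] H) :=
  LinearMap.mkContinuous
    { toFun A := P.adjoint ∘L amplification I A ∘L Q
      map_add' A B := by
        ext u
        have : amplification I (A + B) (Q u) = amplification I A (Q u) + amplification I B (Q u) :=
          rfl
        simp [this]
      map_smul' c A := by
        ext u
        have : amplification I (c • A) (Q u) = c • amplification I A (Q u) := rfl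
        simp [this] }
    (‖P‖ * ‖Q‖)
    fun A => by
      calc ‖P.adjoint ∘L amplification I A ∘L Q‖
          ≤ ‖P.adjoint‖ * (‖amplification I A‖ * ‖Q‖) :=
            (ContinuousLinearMap.opNorm_comp_le _ _).trans
              (by gcongr; exact ContinuousLinearMap.opNorm_comp_le _ _)
        _ ≤ ‖P‖ * (‖A‖ * ‖Q‖) := by
            rw [LinearIsometryEquiv.norm_map]
            gcongr
            exact norm_amplification_le A
        _ = ‖P‖ * ‖Q‖ * ‖A‖ := by ring

theorem inner_compression (P Q : H →L[ℂ] lp (fun _ : I => H) 2) (A : H →L[ℂ] H) (u v : H) :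
    HasSum (fun i => inner ℂ (P v i) (A (Q u i))) (inner ℂ v (compression P Q A u)) := by
  have h : inner ℂ v (compression P Q A u) = inner ℂ (P v) (amplification I A (Q u)) :=
    ContinuousLinearMap.adjoint_inner_right P v (amplification I A (Q u))
  rw [h]
  exact lp.hasSum_inner (P v) (amplification I A (Q u))

/-- Exchanging the sums over I and `Fin n` turns the matrix coefficient of the block operator of
compressions into one of the amplified `blockOperator A`, between vectors of norm at most ‖P‖ and
‖Q‖. -/
theorem cbNorm_compression_le (P Q : H →L[ℂ] lp (fun _ : I => H) 2) :
    cbNorm (compression P Q) ≤ ENNReal.ofReal (‖P‖ * ‖Q‖) := by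
  refine cbNorm_le_iff.2 fun n A hA u v hu hv => ?_
  rw [← ofReal_norm]
  refine ENNReal.ofReal_le_ofReal ?_
  obtain ⟨U, hU, hU'⟩ := exists_lp_piLp fun j => Q (u j)
  obtain ⟨W, hW, hW'⟩ := exists_lp_piLp fun j => P (v j)
  have key : ∀ (R : H →L[ℂ] lp (fun _ : I => H) 2) (w : PiLp 2 (fun _ : Fin n => H))
      (F : lp (fun _ : I => PiLp 2 (fun _ : Fin n => H)) 2), ‖w‖ = 1 →
      ‖F‖ ^ 2 = ∑ j, ‖R (w j)‖ ^ 2 → ‖F‖ ≤ ‖R‖ := by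
    intro R w F hw hF
    refine (sq_le_sq₀ (norm_nonneg F) (norm_nonneg R)).1 ?_
    rw [hF]
    calc ∑ j, ‖R (w j)‖ ^ 2 ≤ ∑ j, (‖R‖ * ‖w j‖) ^ 2 := by
          gcongr
          exact R.le_opNorm _
      _ = ‖R‖ ^ 2 * ‖w‖ ^ 2 := by
          rw [PiLp.norm_sq_eq_of_L2, Finset.mul_sum]
          simp_rw [mul_pow]
      _ = ‖R‖ ^ 2 := by rw [hw]; ring
  have h1 : HasSum (fun i => ∑ k, ∑ j, inner ℂ (P (v k) i) (A k j (Q (u j) i)))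
      (blockFunctional A u v (compression P Q)) := by
    rw [blockFunctional_apply, PiLp.inner_apply]
    simp_rw [blockOperator_apply, inner_sum]
    exact hasSum_sum fun k _ => hasSum_sum fun j _ => inner_compression P Q (A k j) (u j) (v k)
  have h2 : HasSum (fun i => ∑ k, ∑ j, inner ℂ (P (v k) i) (A k j (Q (u j) i)))
      (inner ℂ W (amplification I (blockOperator A) U)) := by
    refine (lp.hasSum_inner W (amplification I (blockOperator A) U)).congr_fun fun i => ?_
    rw [amplification_apply, PiLp.inner_apply]
    simp_rw [blockOperator_apply, inner_sum, hU, hW]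
  rw [h1.unique h2]
  calc ‖inner ℂ W (amplification I (blockOperator A) U)‖
      ≤ ‖W‖ * (1 * ‖U‖) := (norm_inner_le_norm _ _).trans (by
        gcongr
        exact ((amplification I (blockOperator A)).le_of_opNorm_le
          ((norm_amplification_le _).trans hA) U))
    _ ≤ ‖P‖ * ‖Q‖ := by
        rw [one_mul]
        gcongr
        · exact key P v W hv hW'
        · exact key Q u U hu hU'

end Compression

end CompletelyBounded

/-! ### Schur multipliers -/

section Schur

variable {V : Type*}

theorem matrixEntry_eq_apply_single [inst : DecidableEq V] (A : BoundedOps V) (x y : V) :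
    matrixEntry A x y = A (lp.single 2 y (1 : ℂ)) x := by
  rw [Subsingleton.elim inst fun a b => Classical.propDecidable (a = b)]
  rfl

theorem matrixEntry_eq_inner [DecidableEq V] (A : BoundedOps V) (x y : V) :
    matrixEntry A x y = inner ℂ (lp.single 2 x (1 : ℂ) : EllTwo V) (A (lp.single 2 y (1 : ℂ))) := by
  rw [lp.inner_single_left, matrixEntry_eq_apply_single]
  simp

/-- The matrix entry `A_{x,y}` as a continuous linear functional of `A`. -/
noncomputable def matrixEntryCLM (x y : V) : BoundedOps V →L[ℂ] ℂ :=
  open Classical in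
  lp.evalCLM ℂ (fun _ : V => ℂ) 2 x ∘L
    ContinuousLinearMap.apply ℂ (EllTwo V) (lp.single 2 y (1 : ℂ))

theorem matrixEntryCLM_apply (A : BoundedOps V) (x y : V) :
    matrixEntryCLM x y A = matrixEntry A x y := rfl

theorem BoundedOps.ext_matrixEntry {A B : BoundedOps V}
    (h : ∀ x y, matrixEntry A x y = matrixEntry B x y) : A = B := by
  classical
  refine lp.ext_continuousLinearMap (by norm_num) fun y => ?_
  ext x
  have := h x y
  simp only [matrixEntry] at this
  simp only [ContinuousLinearMap.comp_apply, lp.singleContinuousLinearMap_apply]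
  convert this

namespace IsSchurMultiplier

variable {k k' : V → V → ℂ} {m m' : BoundedOps V →L[ℂ] BoundedOps V}

theorem unique (h : IsSchurMultiplier k m) (h' : IsSchurMultiplier k m') : m = m' := by
  ext1 A
  exact BoundedOps.ext_matrixEntry fun x y => by rw [h, h']

theorem sub (h : IsSchurMultiplier k m) (h' : IsSchurMultiplier k' m') :
    IsSchurMultiplier (fun x y => k x y - k' x y) (m - m') := fun A x y => by
  rw [← matrixEntryCLM_apply, sub_apply, map_sub]
  simp only [matrixEntryCLM_apply, h A x y, h' A x y]
  ring

theorem smul (c : ℂ) (h : IsSchurMultiplier k m) :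
    IsSchurMultiplier (fun x y => c * k x y) (c • m) := fun A x y => by
  rw [← matrixEntryCLM_apply, smul_apply, map_smul]
  simp only [matrixEntryCLM_apply, h A x y, smul_eq_mul]
  ring

theorem hasSum {ι : Type*} {k : ι → V → V → ℂ} {m : ι → BoundedOps V →L[ℂ] BoundedOps V}
    {k' : V → V → ℂ} {m' : BoundedOps V →L[ℂ] BoundedOps V}
    (h : ∀ i, IsSchurMultiplier (k i) (m i)) (hm : HasSum m m')
    (hk : ∀ x y, HasSum (fun i => k i x y) (k' x y)) : IsSchurMultiplier k' m' := fun A x y => by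
  have h1 := (matrixEntryCLM x y ∘L ContinuousLinearMap.apply ℂ (BoundedOps V) A).hasSum hm
  have h2 := (hk x y).mul_right (matrixEntry A x y)
  refine h1.unique (h2.congr_fun fun i => ?_)
  exact h i A x y

theorem sum {ι : Type*} {s : Finset ι} {k : ι → V → V → ℂ}
    {m : ι → BoundedOps V →L[ℂ] BoundedOps V} (h : ∀ i ∈ s, IsSchurMultiplier (k i) (m i)) :
    IsSchurMultiplier (fun x y => ∑ i ∈ s, k i x y) (∑ i ∈ s, m i) := fun A x y => by
  rw [← matrixEntryCLM_apply, sum_apply, map_sum, Finset.sum_mul]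
  exact Finset.sum_congr rfl fun i hi => h i hi A x y

end IsSchurMultiplier

/-- Matrix units recover the kernel from m. Eliminating the kernel leaves equations in m alone, each
of them closed. -/
theorem isSchurMultiplier_iff_matrixUnit [DecidableEq V] {m : BoundedOps V →L[ℂ] BoundedOps V} :
    (∃ k, IsSchurMultiplier k m) ↔ ∀ (A : BoundedOps V) (x y : V), matrixEntry (m A) x y =
      matrixEntry (m (InnerProductSpace.rankOne ℂ (lp.single 2 x (1 : ℂ) : EllTwo V)
        (lp.single 2 y (1 : ℂ) : EllTwo V))) x y * matrixEntry A x y := by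
  refine ⟨?_, fun h => ⟨_, h⟩⟩
  rintro ⟨k, hk⟩ A x y
  rw [hk, hk]
  have : matrixEntry (InnerProductSpace.rankOne ℂ (lp.single 2 x (1 : ℂ) : EllTwo V)
      (lp.single 2 y (1 : ℂ) : EllTwo V)) x y = 1 := by
    rw [matrixEntry_eq_inner]
    simp
  rw [this, mul_one]

theorem isClosed_schurMultipliers :
    IsClosed (schurMultipliers V : Set (BoundedOps V →L[ℂ] BoundedOps V)) := by
  classical
  have h : (schurMultipliers V : Set (BoundedOps V →L[ℂ] BoundedOps V)) =
      ⋂ (A : BoundedOps V) (x : V) (y : V),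
        {m | matrixEntryCLM x y (m A) = matrixEntryCLM x y
          (m (InnerProductSpace.rankOne ℂ (lp.single 2 x (1 : ℂ) : EllTwo V)
            (lp.single 2 y (1 : ℂ) : EllTwo V))) * matrixEntryCLM x y A} := by
    ext m
    simp only [mem_iInter, mem_ofPred_eq, matrixEntryCLM_apply]
    exact isSchurMultiplier_iff_matrixUnit
  rw [h]
  refine isClosed_iInter fun A => isClosed_iInter fun x => isClosed_iInter fun y =>
    isClosed_eq ?_ ?_ <;> fun_prop

/-- The operator `u ↦ (x ↦ p x i * u x)_i` from `ℓ₂(V)` to a direct sum of copies of it. -/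
theorem exists_diagonalColumn {I : Type*} (p : V → I → ℂ) {α : ℝ} (hα : 0 ≤ α)
    (hp : ∀ x, ∑' i, ‖p x i‖ₑ ^ 2 ≤ ENNReal.ofReal α ^ 2) :
    ∃ P : EllTwo V →L[ℂ] lp (fun _ : I => EllTwo V) 2,
      (∀ u i x, P u i x = p x i * u x) ∧ ‖P‖ ≤ α := by
  have hb : ∀ x i, ‖p x i‖ ≤ α := fun x i => by
    have h := (ENNReal.le_tsum i).trans (hp x)
    have h' : ‖p x i‖ₑ ≤ ENNReal.ofReal α := (ENNReal.pow_le_pow_left_iff two_ne_zero).1 h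
    rwa [← ofReal_norm, ENNReal.ofReal_le_ofReal_iff hα] at h'
  let D : I → EllTwo V →L[ℂ] EllTwo V := fun i =>
    lp.mapCLM 2 (fun x => p x i • ContinuousLinearMap.id ℂ ℂ) hα fun x => by
      refine (norm_smul_le _ _).trans ?_
      simpa using hb x i
  have hD : ∀ i u x, D i u x = p x i * u x := fun i u x => rfl
  have hsum : ∀ u : EllTwo V, ∑' i, ‖D i u‖ₑ ^ 2 ≤ (ENNReal.ofReal α * ‖u‖ₑ) ^ 2 := fun u => by
    simp_rw [lp.enorm_sq_eq_tsum, hD, enorm_mul, mul_pow]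
    -- Tonelli: summing over i first brings in the bound on the row p x.
    rw [ENNReal.tsum_comm, lp.enorm_sq_eq_tsum, ← ENNReal.tsum_mul_left]
    refine ENNReal.tsum_le_tsum fun x => ?_
    rw [ENNReal.tsum_mul_right]
    gcongr
    exact hp x
  have hmem : ∀ u : EllTwo V, Memℓp (fun i => D i u) 2 := fun u =>
    memℓp_two_iff_tsum_enorm.2 (ne_top_of_le_ne_top (by finiteness) (hsum u))
  refine ⟨LinearMap.mkContinuous
    { toFun u := ⟨fun i => D i u, hmem u⟩
      map_add' u v := by ext i : 2; exact map_add (D i) u v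
      map_smul' c u := by ext i : 2; exact map_smul (D i) c u } α fun u => ?_,
    fun u i x => hD i u x, LinearMap.mkContinuous_norm_le _ hα _⟩
  have h : ‖(⟨fun i => D i u, hmem u⟩ : lp (fun _ : I => EllTwo V) 2)‖ₑ ^ 2
      ≤ (ENNReal.ofReal α * ‖u‖ₑ) ^ 2 := by
    rw [lp.enorm_sq_eq_tsum]
    exact hsum u
  have h' := (ENNReal.pow_le_pow_left_iff two_ne_zero).1 h
  rw [← ofReal_norm, ← ofReal_norm, ← ENNReal.ofReal_mul hα,
    ENNReal.ofReal_le_ofReal_iff (by positivity)] at h'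
  exact h'

/-- A kernel that factors through a Hilbert space is a completely bounded Schur multiplier. -/
theorem exists_schurMultiplier_of_tsum {I : Type*} (p q : V → I → ℂ) {α β : ℝ} (hα : 0 ≤ α)
    (hβ : 0 ≤ β) (hp : ∀ x, ∑' i, ‖p x i‖ₑ ^ 2 ≤ ENNReal.ofReal α ^ 2)
    (hq : ∀ x, ∑' i, ‖q x i‖ₑ ^ 2 ≤ ENNReal.ofReal β ^ 2) :
    ∃ m : schurMultipliers V,
      IsSchurMultiplier (fun x y => ∑' i, p x i * q y i) (m : BoundedOps V →L[ℂ] BoundedOps V) ∧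
      cbNorm (m : BoundedOps V →L[ℂ] BoundedOps V) ≤ ENNReal.ofReal (α * β) := by
  classical
  -- Conjugated because P enters through the conjugate-linear slot of the inner product.
  obtain ⟨P, hP, hPα⟩ := exists_diagonalColumn (fun x i => star (p x i)) hα (by simpa using hp)
  obtain ⟨Q, hQ, hQβ⟩ := exists_diagonalColumn q hβ hq
  have h : IsSchurMultiplier (fun x y => ∑' i, p x i * q y i) (compression P Q) := fun A x y => by
    rw [matrixEntry_eq_inner, ← (inner_compression P Q A _ _).tsum_eq, ← tsum_mul_right]
    congr 1
    ext i
    have h1 : P (lp.single 2 x 1) i = star (p x i) • lp.single 2 x (1 : ℂ) := by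
      ext z
      rw [hP]
      by_cases hz : z = x <;> simp [lp.single_apply, hz]
    have h2 : Q (lp.single 2 y 1) i = q y i • lp.single 2 y (1 : ℂ) := by
      ext z
      rw [hQ]
      by_cases hz : z = y <;> simp [lp.single_apply, hz]
    rw [h1, h2, map_smul, inner_smul_left, inner_smul_right, matrixEntry_eq_inner]
    simp [mul_assoc]
  exact ⟨⟨compression P Q, _, h⟩, h, (cbNorm_compression_le P Q).trans
    (ENNReal.ofReal_le_ofReal (by gcongr))⟩

end Schur

/-! ### Geometry of hyperbolic graphs -/

namespace SimpleGraph

variable {V : Type*} {G : SimpleGraph V}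

theorem Connected.exists_isGeodesicSegment (hconn : G.Connected) (x y : V) :
    ∃ p : ℕ → V, (∀ i ≤ G.dist x y, G.dist x (p i) = i ∧ G.dist (p i) y + i = G.dist x y) ∧
      G.IsGeodesicSegment x y (p '' Set.Iic (G.dist x y)) := by
  obtain ⟨w, hw⟩ := hconn.exists_walk_length_eq_dist x y
  have hstep : ∀ i j : ℕ, G.dist (w.getVert i) (w.getVert (i + j)) ≤ j := by
    intro i j
    induction j with
    | zero => simp
    | succ j ih =>
      have h : G.dist (w.getVert (i + j)) (w.getVert (i + j + 1)) ≤ 1 := by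
        by_cases hij : i + j < w.length
        · exact (dist_eq_one_iff_adj.2 (w.adj_getVert_succ hij)).le
        · rw [w.getVert_of_length_le (by omega), w.getVert_of_length_le (by omega), dist_self]
          exact zero_le_one
      have := hconn.dist_triangle (u := w.getVert i) (v := w.getVert (i + j))
        (w := w.getVert (i + j + 1))
      rw [← add_assoc]
      omega
  have h0 := w.getVert_zero
  have hn := w.getVert_length
  rw [hw] at hn
  -- The pieces of the walk before i, from i to j and after j have lengths adding up to d(x,y), so
  -- none of them can be shortened.
  have hdist : ∀ i j, i ≤ j → j ≤ G.dist x y → G.dist (w.getVert i) (w.getVert j) = j - i := by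
    intro i j hij hj
    have h1 := hstep 0 i
    have h2 := hstep i (j - i)
    have h3 := hstep j (G.dist x y - j)
    have h4 := hconn.dist_triangle (u := x) (v := w.getVert i) (w := w.getVert j)
    have h5 := hconn.dist_triangle (u := x) (v := w.getVert j) (w := y)
    rw [zero_add, h0] at h1
    rw [Nat.add_sub_cancel' hij] at h2
    rw [Nat.add_sub_cancel' hj, hn] at h3
    omega
  refine ⟨w.getVert, fun i hi => ⟨?_, ?_⟩, G.dist x y, w.getVert, h0, hn, ?_, rfl⟩
  · simpa [h0] using hdist 0 i (Nat.zero_le i) hi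
  · have := hdist i _ hi le_rfl
    rw [hn] at this
    omega
  · intro i hi j hj
    rcases le_total i j with hij | hij
    · rw [hdist i j hij hj, abs_of_nonpos (by omega)]
      omega
    · rw [dist_comm, hdist j i hij hi, abs_of_nonneg (by omega)]
      omega

theorem IsGeodesicSegment.dist_add_dist {x y w : V} {s : Set V}
    (h : G.IsGeodesicSegment x y s) (hw : w ∈ s) : G.dist x w + G.dist w y = G.dist x y := by
  obtain ⟨n, p, rfl, rfl, hp, rfl⟩ := h
  obtain ⟨i, hi, rfl⟩ := hw
  rw [Set.mem_Iic] at hi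
  have h1 := hp 0 (Nat.zero_le _) i hi
  have h2 := hp i hi n le_rfl
  have h3 := hp 0 (Nat.zero_le _) n le_rfl
  rw [abs_of_nonpos (by omega)] at h1 h2 h3
  omega

/-- Any two vertices of a hyperbolic graph are joined by a geodesic whose points are close to the
geodesics between an arbitrary third vertex and the end points. -/
theorem IsHyperbolic.exists_slim (hhyp : G.IsHyperbolic) (hconn : G.Connected) :
    ∃ D : ℕ, ∀ x y : V, ∃ p : ℕ → V, ∀ i ≤ G.dist x y,
      G.dist x (p i) = i ∧ G.dist (p i) y + i = G.dist x y ∧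
      ∀ z, ∃ w, G.dist (p i) w ≤ D ∧
        (G.dist x w + G.dist w z = G.dist x z ∨ G.dist y w + G.dist w z = G.dist y z) := by
  obtain ⟨δ, hδ, h⟩ := hhyp
  obtain ⟨D, hD⟩ := exists_nat_ge δ
  refine ⟨D, fun x y => ?_⟩
  obtain ⟨p, hp, hp'⟩ := hconn.exists_isGeodesicSegment x y
  refine ⟨p, fun i hi => ⟨(hp i hi).1, (hp i hi).2, fun z => ?_⟩⟩
  obtain ⟨q, -, hq⟩ := hconn.exists_isGeodesicSegment y z
  obtain ⟨r, -, hr⟩ := hconn.exists_isGeodesicSegment z x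
  obtain ⟨w, hw, hwd⟩ := (h x y z _ _ _ hp' hq hr).1 (mem_image_of_mem p hi)
  refine ⟨w, by exact_mod_cast (hwd.trans_le hD).le, ?_⟩
  rcases hw with hw | hw
  · exact Or.inr (hq.dist_add_dist hw)
  · left
    have := hr.dist_add_dist hw
    rwa [dist_comm (u := z) (v := w), dist_comm (u := w) (v := x), dist_comm (u := z), add_comm]
      at this

/-- The points at distance about `k` from `x` on the geodesics from `x` to `o`; the geodesics are
thought of as staying at `o` once they have reached it. -/
def shadow (G : SimpleGraph V) (o : V) (c : ℕ) (x : V) (k : ℤ) : Set V :=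
  {w | (G.dist x w : ℤ) ≤ k ∧ (G.dist w o : ℤ) ≤ max (G.dist x o - k) 0 + c}

/-- The two depths add up to n = d(x,o) + d(y,o) + m, so a common point forces d(x,y) ≤ n.
Conversely, go from x to the centre of the triangle x, y, o and spend half of the slack n - d(x,y)
moving towards o. -/
theorem IsHyperbolic.shadow_inter_shadow (hhyp : G.IsHyperbolic) (hconn : G.Connected) (o : V) :
    ∃ c : ℕ, ∀ (x y : V) (m : ℤ),
      (G.shadow o c x (G.dist x o + m / 2) ∩
        G.shadow o c y (G.dist y o + (m + 1) / 2)).Nonempty ↔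
      (G.dist x y : ℤ) ≤ G.dist x o + G.dist y o + m := by
  obtain ⟨D, hD⟩ := hhyp.exists_slim hconn
  refine ⟨2 * D + 2, fun x y m => ⟨?_, fun hm => ?_⟩⟩
  · rintro ⟨w, ⟨hx, -⟩, ⟨hy, -⟩⟩
    have := hconn.dist_triangle (u := x) (v := w) (w := y)
    rw [dist_comm (u := y)] at hy
    omega
  · obtain ⟨p, hp⟩ := hD x y
    have hxy := hconn.dist_triangle (u := x) (v := y) (w := o)
    have hyx := hconn.dist_triangle (u := y) (v := x) (w := o)
    rw [dist_comm (u := y) (v := x)] at hyx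
    -- t is half of the slack. Up to rounding, i is the Gromov product of y and o seen from x, so `p
    -- i` is the centre of the triangle on the side from x to y.
    obtain ⟨t, ht⟩ : ∃ t : ℕ, (t : ℤ) = (G.dist x o + G.dist y o + m - G.dist x y) / 2 :=
      ⟨_, Int.toNat_of_nonneg (by omega)⟩
    obtain ⟨i, hi⟩ : ∃ i : ℕ, (i : ℤ) = min (G.dist x o + m / 2 - t) (G.dist x y) :=
      ⟨_, Int.toNat_of_nonneg (by omega)⟩
    obtain ⟨h1, h2, h3⟩ := hp i (by omega)
    obtain ⟨w, hw, hw'⟩ := h3 o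
    obtain ⟨q, hq, -⟩ := hconn.exists_isGeodesicSegment (p i) o
    obtain ⟨h4, h5⟩ := hq (min t (G.dist (p i) o)) (min_le_right _ _)
    set v := q (min t (G.dist (p i) o))
    have h6 := hconn.dist_triangle (u := x) (v := p i) (w := v)
    have h7 := hconn.dist_triangle (u := y) (v := p i) (w := v)
    have h8 := hconn.dist_triangle (u := p i) (v := w) (w := o)
    have h9 := hconn.dist_triangle (u := x) (v := w) (w := p i)
    have h10 := hconn.dist_triangle (u := y) (v := w) (w := p i)
    rw [dist_comm (u := y) (v := p i)] at h7 h10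
    rw [dist_comm (u := w) (v := p i)] at h9 h10
    refine ⟨v, ⟨by omega, ?_⟩, ⟨by omega, ?_⟩⟩
    · rcases hw' with hw' | hw' <;> push_cast <;> omega
    · rcases hw' with hw' | hw' <;> push_cast <;> omega

/-- A point w of the shadow almost realises d(x,o) through depth k. Slimness of the triangle x, o, w
puts it near the point at depth k of one fixed geodesic from x to o. Beyond o, the shadow lies in a
ball around o. -/
theorem IsHyperbolic.exists_encard_shadow_le (hhyp : G.IsHyperbolic) (hconn : G.Connected)
    (hdeg : G.HasBoundedDegree) (o : V) (c : ℕ) :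
    ∃ N : ℕ, ∀ (x : V) (k : ℤ), (G.shadow o c x k).encard ≤ N := by
  obtain ⟨D, hD⟩ := hhyp.exists_slim hconn
  obtain ⟨N, hN⟩ := hdeg ((c + 2 * D + 1 : ℕ) : ℝ) (by positivity)
  refine ⟨N, fun x k => ?_⟩
  suffices ∃ u, ∀ w ∈ G.shadow o c x k, G.dist w u ≤ c + 2 * D by
    obtain ⟨u, hu⟩ := this
    refine (encard_le_encard fun w hw => ?_).trans (hN u)
    exact ⟨u, rfl, by exact_mod_cast Nat.lt_succ_of_le (hu w hw)⟩
  rcases le_total k (G.dist x o) with hk | hk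
  · obtain ⟨p, hp⟩ := hD x o
    refine ⟨p k.toNat, fun w ⟨hw1, hw2⟩ => ?_⟩
    obtain ⟨h1, h2, h3⟩ := hp k.toNat (by omega)
    obtain ⟨v, hv, hv'⟩ := h3 w
    have h4 := hconn.dist_triangle (u := p k.toNat) (v := v) (w := w)
    have h5 := hconn.dist_triangle (u := x) (v := v) (w := p k.toNat)
    have h6 := hconn.dist_triangle (u := o) (v := v) (w := p k.toNat)
    rw [dist_comm (u := v) (v := p k.toNat)] at h5 h6
    rw [dist_comm (u := o) (v := p k.toNat)] at h6
    rw [dist_comm (u := o) (v := w)] at hv'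
    rw [dist_comm]
    rcases hv' with hv' | hv' <;> omega
  · refine ⟨o, fun w ⟨hw1, hw2⟩ => ?_⟩
    omega

theorem shadow_eq_empty {o x : V} {c : ℕ} {k : ℤ} (hk : k < 0) : G.shadow o c x k = ∅ := by
  ext w
  simp only [shadow, mem_ofPred_eq, mem_empty_iff_false, iff_false]
  omega

end SimpleGraph

/-! ### Schur multipliers from shadows -/

section Kernel

variable {V : Type*}

theorem tsum_finset_subset_le {S : Set V} {N : ℕ} (hS : S.encard ≤ N) (c : ℝ≥0∞) :
    ∑' ω : Finset V, (open Classical in if ω.Nonempty ∧ (ω : Set V) ⊆ S then c else 0)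
      ≤ 2 ^ N * c := by
  classical
  obtain ⟨F, rfl⟩ := (finite_of_encard_le_coe hS).exists_finset_coe
  rw [encard_coe_eq_coe_finsetCard, Nat.cast_le] at hS
  rw [tsum_eq_sum (s := F.powerset) fun ω hω => if_neg fun h => hω (by simpa using h.2)]
  calc ∑ ω ∈ F.powerset, (if ω.Nonempty ∧ (ω : Set V) ⊆ F then c else 0)
      ≤ ∑ ω ∈ F.powerset, c := Finset.sum_le_sum fun ω _ => by split_ifs <;> simp
    _ = 2 ^ F.card * c := by simp
    _ ≤ 2 ^ N * c := by
        gcongr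
        exact one_le_two

/-- The alternating sum over all subsets of a nonempty finite set vanishes; discarding the empty
subset and changing sign leaves 1. -/
theorem tsum_finset_subset_neg_one_pow {S : Set V} (hS : S.Finite) :
    ∑' ω : Finset V, (open Classical in
      if ω.Nonempty ∧ (ω : Set V) ⊆ S then (-1 : ℂ) ^ (ω.card + 1) else 0)
      = open Classical in if S.Nonempty then 1 else 0 := by
  classical
  obtain ⟨F, rfl⟩ := hS.exists_finset_coe
  rw [tsum_eq_sum (s := F.powerset) fun ω hω => if_neg fun h => hω (by simpa using h.2)]
  have h : ∀ ω ∈ F.powerset, (if ω.Nonempty ∧ (ω : Set V) ⊆ F then (-1 : ℂ) ^ (ω.card + 1) else 0)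
      = (if ω = ∅ then 1 else 0) - (-1 : ℂ) ^ ω.card := fun ω hω => by
    rw [Finset.mem_powerset] at hω
    rcases ω.eq_empty_or_nonempty with rfl | hne
    · simp
    · simp [hne, hω, hne.ne_empty, pow_succ]
  rw [Finset.sum_congr rfl h, Finset.sum_sub_distrib, Finset.sum_ite_eq',
    if_pos (Finset.empty_mem_powerset F)]
  have h2 := congrArg (Int.cast (R := ℂ)) (Finset.sum_powerset_neg_one_pow_card (x := F))
  push_cast at h2
  rw [h2]
  rcases F.eq_empty_or_nonempty with rfl | hne
  · simp
  · simp [hne, hne.ne_empty]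

/-- The floor of half an integer takes each value exactly twice, hence the factor 2. -/
theorem tsum_int_half_le (g : ℕ → ℝ≥0∞) (b s : ℤ) :
    ∑' j : ℤ, (if 0 ≤ b + (j + s) / 2 then g (b + (j + s) / 2).toNat else 0) ≤ 2 * ∑' k, g k := by
  have h : ∀ j : ℤ, (if 0 ≤ b + (j + s) / 2 then g (b + (j + s) / 2).toNat else 0)
      = ∑' k : ℕ, if (k : ℤ) = b + (j + s) / 2 then g k else 0 := fun j => by
    split_ifs with hj
    · rw [tsum_eq_single (b + (j + s) / 2).toNat fun k hk => if_neg (by omega),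
        if_pos (Int.toNat_of_nonneg hj)]
    · exact (ENNReal.tsum_eq_zero.2 fun k => if_neg (by omega)).symm
  simp_rw [h]
  rw [ENNReal.tsum_comm, ← ENNReal.tsum_mul_left]
  refine ENNReal.tsum_le_tsum fun k => ?_
  rw [tsum_eq_sum (s := {2 * (k - b) - s, 2 * (k - b) + 1 - s}) fun j hj => if_neg fun h => hj ?_]
  · refine (Finset.sum_le_card_nsmul _ _ (g k) fun j _ => by split_ifs <;> simp).trans ?_
    rw [nsmul_eq_mul]
    gcongr
    exact_mod_cast Finset.card_le_two
  · simp only [Finset.mem_insert, Finset.mem_singleton]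
    omega

open Classical in
/-- A square summable family indexed by levels and finite subsets of sets `S k`. -/
noncomputable def levelVector (S : ℤ → Set V) (b s : ℤ) (φ : ℕ → ℂ) (ε : Finset V → ℂ)
    (i : ℤ × Finset V) : ℂ :=
  if i.2.Nonempty ∧ (i.2 : Set V) ⊆ S (b + (i.1 + s) / 2) then
    φ (b + (i.1 + s) / 2).toNat * ε i.2 else 0

theorem tsum_levelVector_le {S : ℤ → Set V} {N : ℕ} (hS : ∀ k, (S k).encard ≤ N)
    (hS' : ∀ k < 0, S k = ∅) (b s : ℤ) (φ : ℕ → ℂ) {ε : Finset V → ℂ} (hε : ∀ ω, ‖ε ω‖ₑ ≤ 1) :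
    ∑' i, ‖levelVector S b s φ ε i‖ₑ ^ 2 ≤ 2 ^ (N + 1) * ∑' k, ‖φ k‖ₑ ^ 2 := by
  classical
  rw [ENNReal.tsum_prod']
  have h : ∀ j : ℤ, ∑' ω, ‖levelVector S b s φ ε (j, ω)‖ₑ ^ 2 ≤ 2 ^ N *
      (if 0 ≤ b + (j + s) / 2 then ‖φ (b + (j + s) / 2).toNat‖ₑ ^ 2 else 0) := fun j => by
    refine le_trans (ENNReal.tsum_le_tsum fun ω => ?_)
      (tsum_finset_subset_le (hS (b + (j + s) / 2)) _)
    simp only [levelVector]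
    by_cases hω : ω.Nonempty ∧ (ω : Set V) ⊆ S (b + (j + s) / 2)
    · have hj : 0 ≤ b + (j + s) / 2 := by
        by_contra! hj
        have := hω.2
        rw [hS' _ hj, subset_empty_iff, Finset.coe_eq_empty] at this
        exact hω.1.ne_empty this
      rw [if_pos hω, if_pos hω, if_pos hj, enorm_mul]
      gcongr
      exact mul_le_of_le_one_right' (hε ω)
    · simp [hω]
  refine (ENNReal.tsum_le_tsum h).trans ?_
  rw [ENNReal.tsum_mul_left, pow_succ, mul_assoc]
  gcongr
  exact tsum_int_half_le (fun k => ‖φ k‖ₑ ^ 2) b s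

theorem summable_mul_of_tsum_enorm_sq {ι : Type*} {f g : ι → ℂ} (hf : ∑' i, ‖f i‖ₑ ^ 2 ≠ ∞)
    (hg : ∑' i, ‖g i‖ₑ ^ 2 ≠ ∞) : Summable fun i => f i * g i := by
  refine Summable.of_norm_bounded
    ((memℓp_two_iff_summable.1 (memℓp_two_iff_tsum_enorm.2 hf)).add
      (memℓp_two_iff_summable.1 (memℓp_two_iff_tsum_enorm.2 hg))) fun i => ?_
  rw [norm_mul]
  nlinarith [sq_nonneg (‖f i‖ - ‖g i‖), sq_nonneg (‖f i‖ + ‖g i‖)]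

/-- At a fixed level the common ω are those contained in the intersection, and the signs carried by
the second vector collapse their sum to an indicator. Square summability justifies summing level by
level. -/
theorem tsum_levelVector_mul {S T : ℤ → Set V} {N : ℕ} (hS : ∀ k, (S k).encard ≤ N)
    (hS' : ∀ k < 0, S k = ∅) (hT : ∀ k, (T k).encard ≤ N) (hT' : ∀ k < 0, T k = ∅) (b s c t : ℤ)
    {φ ψ : ℕ → ℂ} (hφ : ∑' k, ‖φ k‖ₑ ^ 2 ≠ ∞) (hψ : ∑' k, ‖ψ k‖ₑ ^ 2 ≠ ∞) :
    ∑' i, levelVector S b s φ 1 i * levelVector T c t ψ (fun ω => (-1) ^ (ω.card + 1)) i =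
      ∑' j : ℤ, open Classical in
        if (S (b + (j + s) / 2) ∩ T (c + (j + t) / 2)).Nonempty then
          φ (b + (j + s) / 2).toNat * ψ (c + (j + t) / 2).toNat else 0 := by
  classical
  have h1 := ne_top_of_le_ne_top (by finiteness)
    (tsum_levelVector_le hS hS' b s φ (ε := 1) (by simp))
  have h2 := ne_top_of_le_ne_top (by finiteness)
    (tsum_levelVector_le hT hT' c t ψ (ε := fun ω => (-1) ^ (ω.card + 1)) (by simp))
  rw [(summable_mul_of_tsum_enorm_sq h1 h2).tsum_prod]
  refine tsum_congr fun j => ?_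
  have h3 := tsum_finset_subset_neg_one_pow
    ((finite_of_encard_le_coe (hS (b + (j + s) / 2))).inter_of_left (T (c + (j + t) / 2)))
  rw [← mul_one (φ _ * ψ _), ← mul_ite_zero, ← h3, ← tsum_mul_left]
  refine tsum_congr fun ω => ?_
  simp only [levelVector, subset_inter_iff, Pi.one_apply]
  split_ifs <;> first | tauto | ring

end Kernel

/-! ### The basic family of multipliers on a hyperbolic graph -/

namespace SimpleGraph

variable {V : Type*} {G : SimpleGraph V}

/-- On a hyperbolic graph of bounded degree, each pair of square summable functions `φ`, `ψ` gives a
Schur multiplier whose kernel sums `φ k * ψ l` over one decomposition `n = k + l` of each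
`n ≥ d(x, y)`. -/
theorem IsHyperbolic.exists_schurMultiplier (hhyp : G.IsHyperbolic) (hconn : G.Connected)
    (hdeg : G.HasBoundedDegree) :
    ∃ (K : ℝ) (κ : V → V → ℕ → ℕ), 0 < K ∧ (∀ x y n, G.dist x y ≤ n → κ x y n ≤ n) ∧
      ∀ (φ ψ : ℕ → ℂ) (α β : ℝ), 0 ≤ α → 0 ≤ β → ∑' k, ‖φ k‖ₑ ^ 2 ≤ ENNReal.ofReal α ^ 2 →
        ∑' k, ‖ψ k‖ₑ ^ 2 ≤ ENNReal.ofReal β ^ 2 →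
        ∃ m : schurMultipliers V,
          IsSchurMultiplier (fun x y => ∑' n, if G.dist x y ≤ n then
            φ (κ x y n) * ψ (n - κ x y n) else 0) (m : BoundedOps V →L[ℂ] BoundedOps V) ∧
          cbNorm (m : BoundedOps V →L[ℂ] BoundedOps V) ≤ ENNReal.ofReal (K * (α * β)) := by
  classical
  obtain ⟨o⟩ := hconn.nonempty
  obtain ⟨c, hc⟩ := hhyp.shadow_inter_shadow hconn o
  obtain ⟨N, hN⟩ := hhyp.exists_encard_shadow_le hconn hdeg o c
  have hneg : ∀ x, ∀ k < 0, G.shadow o c x k = ∅ := fun x k hk => shadow_eq_empty hk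
  have hbd : ∀ x y, (G.dist x o : ℤ) ≤ G.dist x y + G.dist y o ∧
      (G.dist y o : ℤ) ≤ G.dist x y + G.dist x o := fun x y => by
    have h1 := hconn.dist_triangle (u := x) (v := y) (w := o)
    have h2 := hconn.dist_triangle (u := y) (v := x) (w := o)
    rw [dist_comm (u := y) (v := x)] at h2
    omega
  -- A crude constant: since 2^(N+1) ≥ 1 it may be squared, which avoids its square root.
  have hpow : ∀ {α : ℝ} {t : ℝ≥0∞}, t ≤ ENNReal.ofReal α ^ 2 →
      2 ^ (N + 1) * t ≤ ENNReal.ofReal (2 ^ (N + 1) * α) ^ 2 := fun {α t} ht => by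
    rw [ENNReal.ofReal_mul (by positivity), mul_pow, ENNReal.ofReal_pow (by norm_num)]
    have h2 : (1 : ℝ≥0∞) ≤ 2 ^ (N + 1) := one_le_pow₀ one_le_two
    rw [ENNReal.ofReal_ofNat, sq (2 ^ (N + 1))]
    gcongr
    exact le_mul_of_one_le_left' h2
  refine ⟨2 ^ (N + 1) * 2 ^ (N + 1),
    fun x y n => (G.dist x o + ((n : ℤ) - G.dist x o - G.dist y o) / 2).toNat, by positivity,
    fun x y n hn => ?_, fun φ ψ α β hα hβ hφ hψ => ?_⟩
  · have := hbd x y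
    dsimp only
    omega
  obtain ⟨m, hm, hm'⟩ := exists_schurMultiplier_of_tsum
    (fun x => levelVector (G.shadow o c x) (G.dist x o) 0 φ 1)
    (fun y => levelVector (G.shadow o c y) (G.dist y o) 1 ψ fun ω => (-1) ^ (ω.card + 1))
    (α := 2 ^ (N + 1) * α) (β := 2 ^ (N + 1) * β) (by positivity) (by positivity)
    (fun x => (tsum_levelVector_le (hN x) (hneg x) _ _ _ (by simp)).trans (hpow hφ))
    (fun x => (tsum_levelVector_le (hN x) (hneg x) _ _ _ (by simp)).trans (hpow hψ))
  refine ⟨m, ?_, hm'.trans (ENNReal.ofReal_le_ofReal (le_of_eq (by ring)))⟩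
  convert hm using 3 with x y
  rw [tsum_levelVector_mul (hN x) (hneg x) (hN y) (hneg y) _ _ _ _
    (ne_top_of_le_ne_top (by finiteness) hφ) (ne_top_of_le_ne_top (by finiteness) hψ)]
  trans ∑' j : ℤ, if (G.dist x y : ℤ) ≤ G.dist x o + G.dist y o + j then
    φ (G.dist x o + j / 2).toNat * ψ (G.dist y o + (j + 1) / 2).toNat else 0
  swap
  · refine tsum_congr fun j => ?_
    rw [add_zero]
    exact if_congr (hc x y j).symm rfl rfl
  -- Level j stands for n = j + d(x,o) + d(y,o). The halves of j and j + 1 add up to j, so the two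
  -- depths add up to n, and only levels with n ≥ d(x,y) ≥ 0 contribute.
  have hinj : Function.Injective fun n : ℕ => (n : ℤ) - G.dist x o - G.dist y o :=
    fun a b hab => by simpa using hab
  have hb := hbd x y
  rw [← hinj.tsum_eq]
  · refine tsum_congr fun n => ?_
    by_cases hn : G.dist x y ≤ n
    · rw [if_pos hn, if_pos (by omega)]
      congr 2
      dsimp only
      omega
    · rw [if_neg hn, if_neg (by omega)]
  · intro j hj
    rw [Function.mem_support, ne_eq, ite_eq_right_iff, Classical.not_imp] at hj
    refine ⟨(j + G.dist x o + G.dist y o).toNat, ?_⟩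
    simp only
    omega

end SimpleGraph

/-! ### Radial Schur multipliers on hyperbolic graphs -/

namespace SimpleGraph

variable {V : Type*} {G : SimpleGraph V}

/-- The point masses at s and n - s select the case where n is split as s + (n - s). For given x, y
exactly one s in 0, …, n occurs once d(x,y) ≤ n, so n + 1 multipliers of bounded cb norm add up to
the indicator. -/
theorem IsHyperbolic.exists_schurMultiplier_dist_le (hhyp : G.IsHyperbolic) (hconn : G.Connected)
    (hdeg : G.HasBoundedDegree) :
    ∃ C : ℝ, 0 < C ∧ ∀ n : ℕ, ∃ m : schurMultipliers V,
      IsSchurMultiplier (fun x y => if G.dist x y ≤ n then 1 else 0)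
        (m : BoundedOps V →L[ℂ] BoundedOps V) ∧
      cbNorm (m : BoundedOps V →L[ℂ] BoundedOps V) ≤ ENNReal.ofReal (C * (n + 1)) := by
  obtain ⟨K, κ, hK, hκ, h⟩ := hhyp.exists_schurMultiplier hconn hdeg
  refine ⟨K, hK, fun n => ?_⟩
  have hδ : ∀ s : ℕ, ∑' k, ‖(Pi.single s 1 : ℕ → ℂ) k‖ₑ ^ 2 ≤ ENNReal.ofReal 1 ^ 2 := fun s => by
    rw [tsum_eq_single s fun k hk => by simp [hk]]
    simp
  have hm := fun s : ℕ => h (Pi.single s 1) (Pi.single (n - s) 1) 1 1 zero_le_one zero_le_one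
    (hδ s) (hδ (n - s))
  choose m hm hm' using hm
  refine ⟨∑ s ∈ Finset.range (n + 1), m s, ?_, ?_⟩
  · have hsum := IsSchurMultiplier.sum (s := Finset.range (n + 1)) fun s _ => hm s
    rw [Submodule.coe_sum]
    convert hsum using 3 with x y
    have hs : ∀ s ∈ Finset.range (n + 1), (∑' n', if G.dist x y ≤ n' then
        (Pi.single s 1 : ℕ → ℂ) (κ x y n') * (Pi.single (n - s) 1 : ℕ → ℂ) (n' - κ x y n') else 0) =
        if κ x y n = s then (if G.dist x y ≤ n then 1 else 0) else 0 := fun s hs => by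
      rw [Finset.mem_range] at hs
      rw [tsum_eq_single n]
      · by_cases h1 : κ x y n = s
        · simp [h1]
        · simp [h1]
      -- Both masses are hit only if n' = s + (n - s) = n.
      · intro n' hn'
        by_cases h1 : G.dist x y ≤ n'
        · by_cases h2 : κ x y n' = s
          · have := hκ x y n' h1
            rw [if_pos h1, Pi.single_eq_of_ne (i := n - s), mul_zero]
            omega
          · simp [h2]
        · simp [h1]
    rw [Finset.sum_congr rfl hs, Finset.sum_ite_eq]
    by_cases h1 : G.dist x y ≤ n
    · rw [if_pos h1, if_pos (Finset.mem_range_succ_iff.2 (hκ x y n h1))]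
    · simp [h1]
  · rw [Submodule.coe_sum]
    refine (cbNorm_sum_le _ _).trans ((Finset.sum_le_sum fun s _ => hm' s).trans ?_)
    rw [Finset.sum_const, Finset.card_range, nsmul_eq_mul, mul_one, mul_one,
      ← ENNReal.ofReal_natCast, ← ENNReal.ofReal_mul (by positivity), mul_comm K, Nat.cast_succ]

theorem IsHyperbolic.exists_schurMultiplier_dist_eq (hhyp : G.IsHyperbolic) (hconn : G.Connected)
    (hdeg : G.HasBoundedDegree) :
    ∃ C : ℝ, 0 < C ∧ ∀ n : ℕ, ∃ m : schurMultipliers V,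
      IsSchurMultiplier (fun x y => if G.dist x y = n then 1 else 0)
        (m : BoundedOps V →L[ℂ] BoundedOps V) ∧
      cbNorm (m : BoundedOps V →L[ℂ] BoundedOps V) ≤ ENNReal.ofReal (C * (n + 1)) := by
  obtain ⟨C, hC, h⟩ := hhyp.exists_schurMultiplier_dist_le hconn hdeg
  choose m hm hm' using h
  refine ⟨2 * C, by positivity, fun n => ?_⟩
  cases n with
  | zero =>
    refine ⟨m 0, by simpa only [Nat.le_zero] using hm 0, (hm' 0).trans (ENNReal.ofReal_le_ofReal ?_)⟩
    gcongr
    linarith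
  | succ n =>
    refine ⟨m (n + 1) - m n, ?_, ?_⟩
    · rw [Submodule.coe_sub]
      convert (hm (n + 1)).sub (hm n) using 3 with x y
      by_cases h1 : G.dist x y ≤ n
      · rw [if_neg (by omega), if_pos (by omega), if_pos h1, sub_self]
      · by_cases h2 : G.dist x y = n + 1
        · rw [if_pos h2, if_pos h2.le, if_neg h1, sub_zero]
        · rw [if_neg h2, if_neg (by omega), if_neg h1, sub_zero]
    · rw [Submodule.coe_sub]
      refine (cbNorm_sub_le _ _).trans ((add_le_add (hm' (n + 1)) (hm' n)).trans ?_)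
      rw [← ENNReal.ofReal_add (by positivity) (by positivity)]
      refine ENNReal.ofReal_le_ofReal ?_
      push_cast
      nlinarith

/-- With φ and ψ both geometric the unknown splitting of n is irrelevant: the kernel is the tail
∑_{n ≥ d} z^n = z^d/(1-z), and multiplying by 1 - z produces the factor |1-z|. -/
theorem IsHyperbolic.exists_schurMultiplier_pow_dist (hhyp : G.IsHyperbolic) (hconn : G.Connected)
    (hdeg : G.HasBoundedDegree) :
    ∃ C : ℝ, 0 < C ∧ ∀ z ∈ Metric.ball (0 : ℂ) 1, ∃ m : schurMultipliers V,
      IsSchurMultiplier (fun x y => z ^ G.dist x y) (m : BoundedOps V →L[ℂ] BoundedOps V) ∧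
      cbNorm (m : BoundedOps V →L[ℂ] BoundedOps V) ≤
        ENNReal.ofReal (C * ‖1 - z‖ / (1 - ‖z‖)) := by
  obtain ⟨K, κ, hK, hκ, h⟩ := hhyp.exists_schurMultiplier hconn hdeg
  refine ⟨K, hK, fun z hz => ?_⟩
  rw [mem_ball_zero_iff] at hz
  have hz' : 0 < 1 - ‖z‖ := by linarith
  -- Termwise |z|^(2k) ≤ |z|^k, so 1/(1-|z|) bounds the squared norm.
  have hα : ∑' k : ℕ, ‖z ^ k‖ₑ ^ 2 ≤ ENNReal.ofReal √(1 - ‖z‖)⁻¹ ^ 2 := by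
    rw [← ENNReal.ofReal_pow (by positivity), Real.sq_sqrt (by positivity),
      ENNReal.ofReal_inv_of_pos hz', ENNReal.ofReal_sub _ (norm_nonneg z), ENNReal.ofReal_one,
      ofReal_norm, ← ENNReal.tsum_geometric]
    refine ENNReal.tsum_le_tsum fun k => ?_
    rw [enorm_pow, ← pow_mul]
    refine pow_le_pow_right_of_le_one' ?_ (by omega)
    rw [← ofReal_norm, ENNReal.ofReal_le_one]
    exact hz.le
  obtain ⟨m, hm, hm'⟩ := h (fun k => z ^ k) (fun k => z ^ k) _ _ (Real.sqrt_nonneg _)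
    (Real.sqrt_nonneg _) hα hα
  refine ⟨(1 - z) • m, ?_, ?_⟩
  · rw [Submodule.coe_smul]
    convert hm.smul (1 - z) using 3 with x y
    have hn : ∀ n, (if G.dist x y ≤ n then z ^ κ x y n * z ^ (n - κ x y n) else 0) =
        if G.dist x y ≤ n then z ^ n else 0 := fun n => by
      split_ifs with h1
      · rw [← pow_add, Nat.add_sub_cancel' (hκ x y n h1)]
      · rfl
    simp_rw [hn]
    have hinj : Function.Injective fun n : ℕ => G.dist x y + n := add_right_injective _
    rw [← hinj.tsum_eq]
    · simp only [le_add_iff_nonneg_right, zero_le, if_true, pow_add]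
      rw [tsum_mul_left, tsum_geometric_of_norm_lt_one hz]
      have : (1 - z) ≠ 0 := by
        rw [sub_ne_zero]
        rintro rfl
        simp at hz
      field_simp
    · intro n hn
      rw [Function.mem_support, ne_eq, ite_eq_right_iff, Classical.not_imp] at hn
      exact ⟨n - G.dist x y, Nat.add_sub_cancel' hn.1⟩
  · rw [Submodule.coe_smul]
    refine (cbNorm_smul_le _ _).trans ((mul_le_mul_right hm' _).trans (le_of_eq ?_))
    rw [← ofReal_norm, ← ENNReal.ofReal_mul (norm_nonneg _),
      Real.mul_self_sqrt (by positivity)]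
    congr 1
    rw [div_eq_mul_inv]
    ring

end SimpleGraph

/-! ### Power series with coefficients of linear growth -/

theorem summable_succ_mul_pow (C : ℝ) {r : ℝ} (hr : 0 ≤ r) (hr' : r < 1) :
    Summable fun n : ℕ => r ^ n * (C * (n + 1)) := by
  have hr'' : ‖r‖ < 1 := by rwa [Real.norm_of_nonneg hr]
  have h := ((summable_pow_mul_geometric_of_norm_lt_one 1 hr'').add
    (summable_geometric_of_norm_lt_one hr'')).mul_left C
  refine h.congr fun n => ?_
  ring

section PowerSeries

variable {E : Type*} [NormedAddCommGroup E] [NormedSpace ℂ E] {M : ℕ → E} {C : ℝ}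

theorem norm_pow_smul_le_of_linear_growth (hM : ∀ n, ‖M n‖ ≤ C * (n + 1)) {z : ℂ} {r : ℝ}
    (hz : ‖z‖ ≤ r) (n : ℕ) : ‖z ^ n • M n‖ ≤ r ^ n * (C * (n + 1)) := by
  rw [norm_smul, norm_pow]
  have := hM n
  have := norm_nonneg (M n)
  have := (norm_nonneg z).trans hz
  gcongr

theorem hasSum_pow_smul_of_linear_growth [CompleteSpace E] (hM : ∀ n, ‖M n‖ ≤ C * (n + 1)) {z : ℂ} (hz : ‖z‖ < 1) :
    HasSum (fun n => z ^ n • M n) (∑' n, z ^ n • M n) :=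
  (Summable.of_norm_bounded (summable_succ_mul_pow C (norm_nonneg z) hz)
    (norm_pow_smul_le_of_linear_growth hM le_rfl)).hasSum

theorem differentiableOn_tsum_pow_smul_of_linear_growth [CompleteSpace E]
    (hM : ∀ n, ‖M n‖ ≤ C * (n + 1)) :
    DifferentiableOn ℂ (fun z : ℂ => ∑' n, z ^ n • M n) (ball 0 1) := fun z hz => by
  rw [mem_ball_zero_iff] at hz
  obtain ⟨r, hr, hr'⟩ := exists_between hz
  have h : DifferentiableOn ℂ (fun z : ℂ => ∑' n, z ^ n • M n) (ball 0 r) :=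
    Complex.differentiableOn_tsum_of_summable_norm
      (summable_succ_mul_pow C ((norm_nonneg z).trans hr.le) hr')
      (fun n => ((differentiable_id.pow n).smul_const (M n)).differentiableOn) isOpen_ball
      fun n w hw => norm_pow_smul_le_of_linear_growth hM (mem_ball_zero_iff.1 hw).le n
  exact (h.differentiableAt (isOpen_ball.mem_nhds (by simpa using hr))).differentiableWithinAt

/-- Closedness makes p complete, so the series is summed inside p and θ is holomorphic as a map into
p itself. -/
theorem exists_differentiableOn_hasSum_pow_smul [CompleteSpace E] (p : Submodule ℂ E)
    (hp : IsClosed (p : Set E)) (M : ℕ → E) (C : ℝ) (hMp : ∀ n, M n ∈ p) (hM : ∀ n, ‖M n‖ ≤ C * (n + 1)) :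
    ∃ θ : ℂ → p, DifferentiableOn ℂ θ (ball 0 1) ∧
      ∀ z ∈ ball (0 : ℂ) 1, HasSum (fun n => z ^ n • M n) (θ z : E) := by
  have : CompleteSpace p := hp.completeSpace_coe
  have hM' : ∀ n, ‖(⟨M n, hMp n⟩ : p)‖ ≤ C * (n + 1) := hM
  refine ⟨fun z => ∑' n, z ^ n • (⟨M n, hMp n⟩ : p),
    differentiableOn_tsum_pow_smul_of_linear_growth hM', fun z hz => ?_⟩
  exact (hasSum_pow_smul_of_linear_growth hM' (mem_ball_zero_iff.1 hz)).mapL p.subtypeL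

end PowerSeries

/-- The previous result for maps on `𝔹(H)`; passing through a general `H` keeps the unification of
the instances on `𝔹(ℓ₂(V))` cheap. -/
theorem exists_differentiableOn_hasSum_pow_smul_bounded {H : Type*} [NormedAddCommGroup H]
    [NormedSpace ℂ H] [CompleteSpace H] (p : Submodule ℂ ((H →L[ℂ] H) →L[ℂ] (H →L[ℂ] H)))
    (hp : IsClosed (p : Set ((H →L[ℂ] H) →L[ℂ] (H →L[ℂ] H))))
    (M : ℕ → (H →L[ℂ] H) →L[ℂ] (H →L[ℂ] H)) (C : ℝ) (hMp : ∀ n, M n ∈ p)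
    (hM : ∀ n, ‖M n‖ ≤ C * (n + 1)) :
    ∃ θ : ℂ → p, DifferentiableOn ℂ θ (ball 0 1) ∧ ∀ z ∈ ball (0 : ℂ) 1,
      HasSum (fun n => z ^ n • M n) (θ z : (H →L[ℂ] H) →L[ℂ] (H →L[ℂ] H)) := by
  have h := exists_differentiableOn_hasSum_pow_smul p hp M C hMp hM
  exact h


theorem exists_holomorphic_schurMultiplier {V : Type*} (M : ℕ → schurMultipliers V) {C : ℝ}
    (hC : 0 ≤ C) (hM : ∀ n, cbNorm (M n : BoundedOps V →L[ℂ] BoundedOps V) ≤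
      ENNReal.ofReal (C * (n + 1))) :
    ∃ θ : ℂ → schurMultipliers V, DifferentiableOn ℂ θ (ball 0 1) ∧ ∀ z ∈ ball (0 : ℂ) 1,
      HasSum (fun n => z ^ n • (M n : BoundedOps V →L[ℂ] BoundedOps V)) (θ z) := by
  refine exists_differentiableOn_hasSum_pow_smul_bounded (schurMultipliers V)
    isClosed_schurMultipliers (fun n => M n) C (fun n => (M n).2) fun n => ?_
  have h := (enorm_le_cbNorm _).trans (hM n)
  rwa [← ofReal_norm, ENNReal.ofReal_le_ofReal_iff (by positivity)] at h

/-- If `∑ cbNorm (T n)` converges, then the partial sums of `∑ T n` eventually have completely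
bounded norm at most one more than that of the sum. -/
theorem eventually_cbNorm_sum_range_le {H : Type*} [NormedAddCommGroup H] [InnerProductSpace ℂ H]
    {T : ℕ → (H →L[ℂ] H) →L[ℂ] (H →L[ℂ] H)} {S : (H →L[ℂ] H) →L[ℂ] (H →L[ℂ] H)}
    (h : HasSum T S) {u : ℕ → ℝ} (hu : Summable u) (hTu : ∀ n, cbNorm (T n) ≤ ENNReal.ofReal (u n))
    (hu' : ∀ n, 0 ≤ u n) :
    ∀ᶠ N in atTop, cbNorm (∑ k ∈ Finset.range N, T k) ≤ cbNorm S + 1 := by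
  filter_upwards [(tendsto_sum_nat_add u).eventually_le_const zero_lt_one] with N hN
  have h1 := (hasSum_nat_add_iff' N).2 h
  -- The partial sum is S minus the tail, whose cb norm is at most the tail of u.
  rw [← sub_sub_cancel S (∑ k ∈ Finset.range N, T k)]
  refine (cbNorm_sub_le _ _).trans ?_
  gcongr
  refine (cbNorm_le_tsum h1).trans ((ENNReal.tsum_le_tsum fun k => hTu (k + N)).trans ?_)
  rw [← ENNReal.ofReal_tsum_of_nonneg (fun k => hu' _) ((summable_nat_add_iff N).2 hu)]
  exact ENNReal.ofReal_le_one.2 hN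

theorem theorem1 {V : Type*} (G : SimpleGraph V) (hconn : G.Connected)
    (hhyp : G.IsHyperbolic) (hdeg : G.HasBoundedDegree) :
    ∃ C : ℝ, 0 < C ∧
      (∃ θ : ℂ → schurMultipliers V,
        (∀ z ∈ ball (0 : ℂ) 1,
          IsSchurMultiplier (fun x y => z ^ G.dist x y) (θ z) ∧
          cbNorm (θ z : BoundedOps V →L[ℂ] BoundedOps V) ≤
            ENNReal.ofReal (C * ‖1 - z‖ / (1 - ‖z‖))) ∧
        DifferentiableOn ℂ θ (ball (0 : ℂ) 1)) ∧
      (∀ n : ℕ, ∃ m : schurMultipliers V,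
        IsSchurMultiplier (fun x y => ({p : V × V | G.dist p.1 p.2 = n}.indicator 1 (x, y) : ℂ)) m ∧
        cbNorm (m : BoundedOps V →L[ℂ] BoundedOps V) ≤ ENNReal.ofReal (C * (n + 1))) ∧
      (∃ f : ℕ → ℕ → ℝ,
        (∀ n k, f n k ∈ Set.Icc (0 : ℝ) 1) ∧
        (∀ n, (Function.support (f n)).Finite) ∧
        (∀ k, Tendsto (fun n => f n k) atTop (𝓝 1)) ∧
        ∀ n, ∃ m : schurMultipliers V,
          IsSchurMultiplier (fun x y => (f n (G.dist x y) : ℂ)) m ∧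
          cbNorm (m : BoundedOps V →L[ℂ] BoundedOps V) ≤ ENNReal.ofReal C) := by
  obtain ⟨C₁, hC₁, h₁⟩ := hhyp.exists_schurMultiplier_pow_dist hconn hdeg
  obtain ⟨C₂, hC₂, h₂⟩ := hhyp.exists_schurMultiplier_dist_eq hconn hdeg
  choose M hM hM' using h₂
  obtain ⟨θ, hdiff, hsum⟩ := exists_holomorphic_schurMultiplier M hC₂.le hM'
  have hθ : ∀ z ∈ ball (0 : ℂ) 1, IsSchurMultiplier (fun x y => z ^ G.dist x y) (θ z) := by
    refine fun z hz => IsSchurMultiplier.hasSum (fun n => (hM n).smul (z ^ n)) (hsum z hz)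
      fun x y => ?_
    refine (hasSum_ite_eq (G.dist x y) (z ^ G.dist x y)).congr_fun fun n => ?_
    by_cases h : n = G.dist x y
    · simp [h]
    · simp [h, Ne.symm h]
  have hθ' : ∀ z ∈ ball (0 : ℂ) 1, cbNorm (θ z : BoundedOps V →L[ℂ] BoundedOps V) ≤
      ENNReal.ofReal (C₁ * ‖1 - z‖ / (1 - ‖z‖)) := fun z hz => by
    obtain ⟨m, hm, hm'⟩ := h₁ z hz
    -- The kernel determines the multiplier, so the sum of the power series inherits the bound of
    -- the geometric construction.
    rwa [(hθ z hz).unique hm]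
  refine ⟨C₁ + C₂ + 1, by positivity, ⟨θ, fun z hz => ?_, hdiff⟩, fun n => ⟨M n, ?_, ?_⟩, ?_⟩
  · refine ⟨hθ z hz, (hθ' z hz).trans (ENNReal.ofReal_le_ofReal ?_)⟩
    have : 0 < 1 - ‖z‖ := by linarith [mem_ball_zero_iff.1 hz]
    gcongr
    linarith
  · convert hM n using 3 with x y
    simp [indicator_apply]
  · refine (hM' n).trans (ENNReal.ofReal_le_ofReal ?_)
    gcongr
    linarith
  · obtain ⟨r, hr0, hr1, hr⟩ : ∃ r : ℕ → ℝ, (∀ n, 0 ≤ r n) ∧ (∀ n, r n < 1) ∧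
        Tendsto r atTop (𝓝 1) := by
      refine ⟨fun n => 1 - 1 / ((n : ℝ) + 1), fun n => ?_, fun n => ?_, ?_⟩
      · rw [sub_nonneg, div_le_one (by positivity)]
        linarith [n.cast_nonneg (α := ℝ)]
      · rw [sub_lt_self_iff]
        positivity
      · simpa using (tendsto_const_nhds (x := (1 : ℝ))).sub tendsto_one_div_add_atTop_nhds_zero_nat
    have hnorm : ∀ n, ‖(r n : ℂ)‖ = r n := fun n => by
      rw [Complex.norm_real, Real.norm_of_nonneg (hr0 n)]
    have hball : ∀ n, (r n : ℂ) ∈ ball (0 : ℂ) 1 := fun n =>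
      mem_ball_zero_iff.2 ((hnorm n).trans_lt (hr1 n))
    have hev := fun n => eventually_cbNorm_sum_range_le
      (hsum (r n) (hball n)) (summable_succ_mul_pow C₂ (hr0 n) (hr1 n))
      (fun k => by
        refine (cbNorm_smul_le _ _).trans ((mul_le_mul_right (hM' k) _).trans (le_of_eq ?_))
        rw [← ofReal_norm, norm_pow, hnorm, ENNReal.ofReal_mul (pow_nonneg (hr0 n) k)])
      fun k => mul_nonneg (pow_nonneg (hr0 n) k) (by positivity)
    -- Requiring N n ≥ n keeps every fixed k inside the truncation eventually, which gives pointwise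
    -- convergence.
    choose N hNn hN using fun n => ((eventually_ge_atTop n).and (hev n)).exists
    refine ⟨fun n k => if k < N n then r n ^ k else 0, fun n k => ?_, fun n => ?_, fun k => ?_,
      fun n => ⟨∑ k ∈ Finset.range (N n), (r n : ℂ) ^ k • M k, ?_, ?_⟩⟩
    · dsimp only
      split_ifs
      · exact ⟨pow_nonneg (hr0 n) k, pow_le_one₀ (hr0 n) (hr1 n).le⟩
      · exact ⟨le_rfl, zero_le_one⟩
    · refine (finite_lt_nat (N n)).subset fun k hk => ?_
      by_contra h
      exact hk (if_neg h)
    · have h := hr.pow k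
      rw [one_pow] at h
      refine h.congr' ?_
      filter_upwards [eventually_gt_atTop k] with n hn
      rw [if_pos (hn.trans_le (hNn n))]
    · rw [Submodule.coe_sum]
      convert IsSchurMultiplier.sum (s := Finset.range (N n)) fun k _ => (hM k).smul ((r n : ℂ) ^ k)
        using 3 with x y
      · simp only [mul_ite, mul_one, mul_zero, Finset.sum_ite_eq, Finset.mem_range]
        split_ifs <;> simp
      · rfl
    · rw [Submodule.coe_sum]
      refine (hN n).trans ((add_le_add (hθ' (r n) (hball n)) le_rfl).trans ?_)
      have h1 : ‖1 - (r n : ℂ)‖ = 1 - r n := by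
        rw [← Complex.ofReal_one, ← Complex.ofReal_sub, Complex.norm_real,
          Real.norm_of_nonneg (by linarith [hr1 n])]
      -- On [0,1) the ratio |1-r|/(1-|r|) equals 1, so the bound C₁ + 1 is uniform in n.
      rw [h1, hnorm, mul_div_assoc, div_self (by linarith [hr1 n]), mul_one, ← ENNReal.ofReal_one,
        ← ENNReal.ofReal_add hC₁.le zero_le_one]
      exact ENNReal.ofReal_le_ofReal (by linarith)
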